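/- All Boolean algebras below are infinite and all cardinals denoted $\mu,\chi$ are infinite; $\|X\|$ is the cardinality of $X$. A cardinal is weakly inaccessible if it is an uncountable regular limit cardinal. A linear order $(I,<)$ is $\Theta$-like if $\|I\|=\Theta$ and $\|\{b\in I:b<a\}\|<\Theta$ for every $a\in I$. For a family of cardinals $\lambda_i$ ($i<\kappa$) and an ultrafilter $D$ on $\kappa$, $\prod_{i<\kappa}(\lambda_i,<)/D$ is the ultraproduct of the well-ordered sets $(\lambda_i,<)$, and $\prod_{i<\kappa}\lambda_i/D$ is also written for its cardinality. Let $\tau$ be a cardinal function on Boolean algebras of one of the following two kinds. (a) $\tau=\mathrm{inv}_T$ is a definable cardinal invariant: $T$ is a (not necessarily first order) theory in the language of Boolean algebras with additional predicates $P_0,P_1,\ldots$, and $\mathrm{inv}_T(B)=\sup\{\|P_0\|:(B,P_n)_n\text{ is a model of }T\}$. (b) $\tau$ is any isomorphism-invariant function assigning cardinals to Boolean algebras such that $\tau(B)\le\|B\|$ for all $B$. For an operation $\mathbf O$ on families of Boolean algebras, let $\square^\tau_{\mathbf O}$ be the statement: whenever $\mu$ is a cardinal and $B_i$ ($i<\mu^+$)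 are Boolean algebras, $$\sup_{i<\mu}\tau(B_i)\le\tau\big(\mathbf O_{i<\mu}B_i\big)\quad\text{and}\quad \tau\big(\mathbf O_{i<\mu^+}B_i\big)\le\mu+\sup_{i<\mu^+}\tau(B_i).$$ Assume that $\square^\tau_{\mathbf O}$ holds for $\mathbf O$ the free product of Boolean algebras, or for $\mathbf O$ the weak product (the subalgebra of the full product consisting of all $a$ such that $\{i:a_i\ne0\}$ is finite or $\{i:a_i\ne1\}$ is finite). Assume also that for each cardinal $\chi$ there is a Boolean algebra $B$ such that $\chi\le\tau(B)$ and there is no weakly inaccessible cardinal in the interval $(\chi,\|B\|]$. Let $\langle\lambda_i:i<\kappa\rangle$ be a sequence of weakly inaccessible cardinals with $\lambda_i>\kappa^+$, let $D$ be an $\aleph_1$-complete ultrafilter on $\kappa$, and suppose that $\prod_{i<\kappa}(\lambda_i,<)/D$ is $\mu^+$-like for a cardinal $\mu$. Then there are Boolean algebras $B_i$ ($i<\kappa$) such that $\tau(B_i)=\lambda_i$ for all $i<\kappa$ and $\tau\big(\prod_{i<\kappa}B_i/D\big)\le\mu$; consequently $$\prod_{i<\kappa}\tau(B_i)/D=\mu^+>\tau\Big(\prod_{i<\kappa}B_i/D\Big).$$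 -/

import Mathlib

open Cardinal

universe u

namespace BAInv

/-! ### Ultraproducts

`(D : Filter κ).Product A` is Mathlib's quotient of `∀ i, A i` by equality `D`-almost everywhere.
It is given here the coordinatewise order and Boolean operations. -/

section Ultraproduct

open Filter

variable {κ : Type*} (D : Ultrafilter κ)

/-- The order of an ultraproduct: `f/D ≤ g/D` iff `f i ≤ g i` for `D`-almost all `i`. -/
instance instPartialOrderProduct (A : κ → Type*) [∀ i, PartialOrder (A i)] :
    PartialOrder ((D : Filter κ).Product A) where
  le := Quotient.lift₂ (fun f g => ∀ᶠ i in (D : Filter κ), f i ≤ g i) (by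
    intro f g f' g' (hf : ∀ᶠ i in (D : Filter κ), f i = f' i)
      (hg : ∀ᶠ i in (D : Filter κ), g i = g' i)
    refine propext ⟨fun h => ?_, fun h => ?_⟩
    · filter_upwards [h, hf, hg] with i h1 h2 h3
      rw [← h2, ← h3]; exact h1
    · filter_upwards [h, hf, hg] with i h1 h2 h3
      rw [h2, h3]; exact h1)
  le_refl := by
    rintro ⟨f⟩
    exact Eventually.of_forall fun i => le_refl (f i)
  le_trans := by
    rintro ⟨f⟩ ⟨g⟩ ⟨h⟩ (h1 : ∀ᶠ i in (D : Filter κ), f i ≤ g i)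
      (h2 : ∀ᶠ i in (D : Filter κ), g i ≤ h i)
    exact (h1.and h2).mono fun i hi => hi.1.trans hi.2
  le_antisymm := by
    rintro ⟨f⟩ ⟨g⟩ (h1 : ∀ᶠ i in (D : Filter κ), f i ≤ g i)
      (h2 : ∀ᶠ i in (D : Filter κ), g i ≤ f i)
    exact Quotient.sound ((h1.and h2).mono fun i hi => le_antisymm hi.1 hi.2)

/-- An ultraproduct of linear orders is a linear order. -/
noncomputable instance instLinearOrderProduct (A : κ → Type*) [∀ i, LinearOrder (A i)] :
    LinearOrder ((D : Filter κ).Product A) where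
  __ := instPartialOrderProduct D A
  le_total := by
    rintro ⟨f⟩ ⟨g⟩
    exact Ultrafilter.eventually_or.1 (Eventually.of_forall fun i => le_total (f i) (g i))
  toDecidableLE := Classical.decRel _

/-- The strict order of an ultraproduct of linear orders: `f/D < g/D` iff `f i < g i` for
`D`-almost all `i`. -/
theorem lt_iff {A : κ → Type*} [∀ i, LinearOrder (A i)] (f g : ∀ i, A i) :
    LT.lt (α := (D : Filter κ).Product A) (Quotient.mk _ f) (Quotient.mk _ g) ↔
      ∀ᶠ i in (D : Filter κ), f i < g i := by
  refine (not_le (α := (D : Filter κ).Product A)).symm.trans ?_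
  change ¬ (∀ᶠ i in (D : Filter κ), g i ≤ f i) ↔ _
  rw [← Ultrafilter.eventually_not]
  simp only [not_le]

/-- An ultraproduct of Boolean algebras is a Boolean algebra, with operations computed
coordinatewise. -/
instance instBooleanAlgebraProduct (A : κ → Type*) [∀ i, BooleanAlgebra (A i)] :
    BooleanAlgebra ((D : Filter κ).Product A) where
  __ := instPartialOrderProduct D A
  sup := Quotient.map₂ (fun f g i => f i ⊔ g i) (by
    intro f f' (hf : ∀ᶠ i in (D : Filter κ), f i = f' i) g g'
      (hg : ∀ᶠ i in (D : Filter κ), g i = g' i)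
    exact (hf.and hg).mono fun i hi => congrArg₂ (· ⊔ ·) hi.1 hi.2)
  inf := Quotient.map₂ (fun f g i => f i ⊓ g i) (by
    intro f f' (hf : ∀ᶠ i in (D : Filter κ), f i = f' i) g g'
      (hg : ∀ᶠ i in (D : Filter κ), g i = g' i)
    exact (hf.and hg).mono fun i hi => congrArg₂ (· ⊓ ·) hi.1 hi.2)
  compl := Quotient.map (fun f i => (f i)ᶜ) (by
    intro f f' (hf : ∀ᶠ i in (D : Filter κ), f i = f' i)
    exact hf.mono fun i hi => congrArg (·ᶜ) hi)
  top := Quotient.mk _ fun _ => ⊤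
  bot := Quotient.mk _ fun _ => ⊥
  le_sup_left := by
    rintro ⟨f⟩ ⟨g⟩
    exact Eventually.of_forall fun i => (le_sup_left : f i ≤ f i ⊔ g i)
  le_sup_right := by
    rintro ⟨f⟩ ⟨g⟩
    exact Eventually.of_forall fun i => (le_sup_right : g i ≤ f i ⊔ g i)
  sup_le := by
    rintro ⟨f⟩ ⟨g⟩ ⟨h⟩ (h1 : ∀ᶠ i in (D : Filter κ), f i ≤ h i)
      (h2 : ∀ᶠ i in (D : Filter κ), g i ≤ h i)
    exact (h1.and h2).mono fun i hi => sup_le hi.1 hi.2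
  inf_le_left := by
    rintro ⟨f⟩ ⟨g⟩
    exact Eventually.of_forall fun i => (inf_le_left : f i ⊓ g i ≤ f i)
  inf_le_right := by
    rintro ⟨f⟩ ⟨g⟩
    exact Eventually.of_forall fun i => (inf_le_right : f i ⊓ g i ≤ g i)
  le_inf := by
    rintro ⟨f⟩ ⟨g⟩ ⟨h⟩ (h1 : ∀ᶠ i in (D : Filter κ), f i ≤ g i)
      (h2 : ∀ᶠ i in (D : Filter κ), f i ≤ h i)
    exact (h1.and h2).mono fun i hi => le_inf hi.1 hi.2
  le_sup_inf := by
    rintro ⟨f⟩ ⟨g⟩ ⟨h⟩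
    exact Eventually.of_forall fun i => (le_sup_inf : (f i ⊔ g i) ⊓ (f i ⊔ h i) ≤ f i ⊔ g i ⊓ h i)
  inf_compl_le_bot := by
    rintro ⟨f⟩
    exact Eventually.of_forall fun i => BooleanAlgebra.inf_compl_le_bot (f i)
  top_le_sup_compl := by
    rintro ⟨f⟩
    exact Eventually.of_forall fun i => BooleanAlgebra.top_le_sup_compl (f i)
  le_top := by
    rintro ⟨f⟩
    exact Eventually.of_forall fun i => (le_top : f i ≤ ⊤)
  bot_le := by
    rintro ⟨f⟩
    exact Eventually.of_forall fun i => (bot_le : ⊥ ≤ f i)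

end Ultraproduct

/-- The ultraproduct `∏ B_i / D` as a bundled Boolean algebra. -/
def ultraprod {κ : Type u} (D : Ultrafilter κ) (B : κ → BoolAlg.{u}) : BoolAlg.{u} :=
  BoolAlg.of ((D : Filter κ).Product fun i => B i)

/-- The ultraproduct of the cardinals `lam i`, each regarded as the well-ordered set
`({α : α < lam i}, <)`. Its order is the ultraproduct order, its cardinality is the cardinal
`∏ lam i / D`. -/
abbrev CardProd {κ : Type u} (D : Ultrafilter κ) (lam : κ → Cardinal.{u}) : Type u :=
  (D : Filter κ).Product fun i => (lam i).ord.ToType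

/-! ### Free products and weak products -/

/-- The points of the Stone space of `A`: homomorphisms of `A` into the two-element Boolean algebra
`Prop`, that is, ultrafilters of `A`. -/
abbrev Ult (A : BoolAlg.{u}) : Type u := BoundedLatticeHom A Prop

/-- The cylinder `{x ∈ ∏ Ult (A i) : a ∈ x i}` determined by `a ∈ A i`. -/
def cylinder {ι : Type u} (A : ι → BoolAlg.{u}) (i : ι) (a : A i) : Set (∀ i, Ult (A i)) :=
  {x | x i a}

/-- The free product of a family of Boolean algebras: the algebra of subsets of the product of the
Stone spaces that is generated by all cylinders (that is, the algebra of clopen subsets of this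
product). -/
def freeProduct {ι : Type u} (A : ι → BoolAlg.{u}) : BoolAlg.{u} :=
  BoolAlg.of (BooleanSubalgebra.closure {s | ∃ i a, s = cylinder A i a})

/-- The weak product of a family of Boolean algebras: the subalgebra of the full product consisting
of those `a` with `a i = 0` for all but finitely many `i`, or `a i = 1` for all but finitely
many `i`. -/
def weakSubalgebra {ι : Type u} (A : ι → BoolAlg.{u}) : BooleanSubalgebra (∀ i, A i) where
  carrier := {a | {i | a i ≠ ⊥}.Finite ∨ {i | a i ≠ ⊤}.Finite}
  supClosed' := by
    rintro a (ha | ha) b (hb | hb)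
    · refine Or.inl ((ha.union hb).subset fun i hi => ?_)
      by_contra h
      simp only [Set.mem_union, Set.mem_ofPred_eq, not_or, not_not] at h
      exact hi (by simp [h.1, h.2])
    · exact Or.inr (hb.subset fun i hi h => hi (by simp [h]))
    · exact Or.inr (ha.subset fun i hi h => hi (by simp [h]))
    · exact Or.inr (ha.subset fun i hi h => hi (by simp [h]))
  infClosed' := by
    rintro a (ha | ha) b (hb | hb)
    · exact Or.inl (ha.subset fun i hi h => hi (by simp [h]))
    · exact Or.inl (ha.subset fun i hi h => hi (by simp [h]))
    · exact Or.inl (hb.subset fun i hi h => hi (by simp [h]))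
    · refine Or.inr ((ha.union hb).subset fun i hi => ?_)
      by_contra h
      simp only [Set.mem_union, Set.mem_ofPred_eq, not_or, not_not] at h
      exact hi (by simp [h.1, h.2])
  compl_mem' := by
    rintro a (ha | ha)
    · exact Or.inr (ha.subset fun i hi h => hi (by simp [h]))
    · exact Or.inl (ha.subset fun i hi h => hi (by simp [h]))
  bot_mem' := Or.inl (by simp)

/-- The weak product as a bundled Boolean algebra. -/
def weakProduct {ι : Type u} (A : ι → BoolAlg.{u}) : BoolAlg.{u} :=
  BoolAlg.of (weakSubalgebra A)

/-! ### Cardinal invariants -/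

/-- A theory, not necessarily first order, in the language of Boolean algebras with additional
predicates `P 0, P 1, …`, where `P n` has arity `arity n`. As no logic is fixed, a theory is given
by the class of its models, which may be any class of structures `(B, P 0, P 1, …)` that is closed
under isomorphism. -/
structure Theory where
  /-- The arities of the predicates. -/
  arity : ℕ → ℕ
  /-- The expansion `(B, P 0, P 1, …)` is a model of the theory. -/
  Models : ∀ B : BoolAlg.{u}, (∀ n, Set (Fin (arity n) → B)) → Prop
  /-- Isomorphic structures satisfy the same theories. -/
  models_of_iso : ∀ (A B : BoolAlg.{u}) (e : A ≃o B) (P : ∀ n, Set (Fin (arity n) → A)),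
    Models A P → Models B fun n => (fun v => e ∘ v) '' P n

/-- The definable cardinal invariant of the theory `T`:
`inv_T(B) = sup {‖P₀‖ : (B, P₀, P₁, …) is a model of T}`. -/
noncomputable def Theory.inv (T : Theory.{u}) (B : BoolAlg.{u}) : Cardinal.{u} :=
  sSup {c | ∃ P : ∀ n, Set (Fin (T.arity n) → B), T.Models B P ∧ c = #(P 0)}

/-- `τ` takes the same value on isomorphic infinite Boolean algebras. -/
def IsInvariant (τ : BoolAlg.{u} → Cardinal.{u}) : Prop :=
  ∀ A B : BoolAlg.{u}, Infinite A → Nonempty (A ≃o B) → τ A = τ B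

/-- The property `□` of the cardinal function `τ` for an operation `O` on families of Boolean
algebras: for every infinite cardinal `μ`, `sup_i τ(B_i) ≤ τ(O_i B_i)` for families of `μ` infinite
Boolean algebras, and `τ(O_i B_i) ≤ μ + sup_i τ(B_i)` for families of `μ⁺` infinite Boolean
algebras. -/
def Square (τ : BoolAlg.{u} → Cardinal.{u})
    (O : ∀ {ι : Type u}, (ι → BoolAlg.{u}) → BoolAlg.{u}) : Prop :=
  ∀ μ : Cardinal.{u}, ℵ₀ ≤ μ →
    (∀ (ι : Type u) (B : ι → BoolAlg.{u}), #ι = μ → (∀ i, Infinite (B i)) →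
      ⨆ i, τ (B i) ≤ τ (O B)) ∧
    (∀ (ι : Type u) (B : ι → BoolAlg.{u}), #ι = Order.succ μ → (∀ i, Infinite (B i)) →
      τ (O B) ≤ μ + ⨆ i, τ (B i))

/-- Weakly inaccessible cardinals: uncountable regular limit cardinals. -/
def IsWeaklyInaccessible (c : Cardinal.{u}) : Prop :=
  ℵ₀ < c ∧ c.IsRegular ∧ Order.IsSuccLimit c

/-- A linear order is `Θ`-like if it has cardinality `Θ` and all its proper initial segments
`{b : b < a}` have cardinality less than `Θ`. -/
def IsLike (I : Type u) [LinearOrder I] (Θ : Cardinal.{u}) : Prop :=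
  #I = Θ ∧ ∀ a : I, #{b : I // b < a} < Θ

end BAInv

namespace BAInv

/-! ### Generation of Boolean algebras -/

section Generation

variable {F : Type*} [BooleanAlgebra F]

/-! Write O for the free or the weak product. For each ordinal α below λ_i pick an algebra A_{i,α}
with |α| ≤ τ(A_{i,α}) and size below λ_i; such algebras exist because a size of at least λ_i would
put the weakly inaccessible λ_i itself into a forbidden interval. Let B_i be the O-product of the
A_{i,α} over all α. It has size at most λ_i, so τ(B_i) ≤ λ_i, and the first half of `Square` gives
τ(B_i) ≥ sup |α| = λ_i.

The main point is that O commutes with ultraproducts modulo D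
(`nonempty_orderIso_ultraprod_freeProduct`, `nonempty_orderIso_ultraprod_weakProduct`). An element
of an O-product has a finite description, and ℵ₁-completeness makes the size of that description
constant almost everywhere. So the ultraproduct of the B_i is the O-product, over x in ∏ λ_i / D, of
the algebras C_x = ∏ A_{i,x(i)} / D. The index set has size μ⁺, while each C_x embeds into a proper
initial segment of it (`exists_mk_product_le`), so by μ⁺-likeness C_x has size at most μ. The second
half of `Square` then bounds τ by μ + μ = μ. -/

/-- The elements obtained from `S` and `⊥` by at most `n` nested joins and complements. -/
def closureLevel (S : Set F) : ℕ → Set F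
  | 0 => insert ⊥ S
  | n + 1 => closureLevel S n ∪ Set.image2 (· ⊔ ·) (closureLevel S n) (closureLevel S n) ∪
      compl '' closureLevel S n

theorem closureLevel_mono (S : Set F) : Monotone (closureLevel S) :=
  monotone_nat_of_le_succ fun _ _ ha => Or.inl (Or.inl ha)

theorem exists_mem_closureLevel {S : Set F} {a : F} (ha : a ∈ BooleanSubalgebra.closure S) :
    ∃ n, a ∈ closureLevel S n := by
  induction ha using BooleanSubalgebra.closure_bot_sup_induction with
  | mem x hx => exact ⟨0, Or.inr hx⟩
  | bot => exact ⟨0, Or.inl rfl⟩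
  | sup x _ y _ hx hy =>
    obtain ⟨m, hm⟩ := hx
    obtain ⟨n, hn⟩ := hy
    exact ⟨max m n + 1, Or.inl (Or.inr ⟨x, closureLevel_mono S (le_max_left m n) hm, y,
      closureLevel_mono S (le_max_right m n) hn, rfl⟩)⟩
  | compl x _ hx =>
    obtain ⟨n, hn⟩ := hx
    exact ⟨n + 1, Or.inr ⟨x, hn, rfl⟩⟩

theorem mk_closure_le {F : Type u} [BooleanAlgebra F] {S : Set F} {c : Cardinal.{u}}
    (hc : ℵ₀ ≤ c) (hS : #S ≤ c) : #(BooleanSubalgebra.closure S) ≤ c := by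
  have hlevel : ∀ n, #(closureLevel S n) ≤ c := by
    intro n
    induction n with
    | zero =>
      exact (mk_insert_le).trans (add_le_of_le hc hS (one_le_aleph0.trans hc))
    | succ n ih =>
      refine (mk_union_le _ _).trans (add_le_of_le hc ((mk_union_le _ _).trans
        (add_le_of_le hc ih ?_)) (mk_image_le.trans ih))
      rw [← Set.image_prod]
      refine mk_image_le.trans ?_
      rw [mk_setProd]
      exact (mul_le_mul' (by simpa using ih) (by simpa using ih)).trans (mul_eq_self hc).le
  have hsub : (BooleanSubalgebra.closure S : Set F) ⊆ ⋃ n, closureLevel S n := fun a ha =>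
    Set.mem_iUnion.2 (exists_mem_closureLevel ha)
  refine (mk_le_mk_of_subset hsub).trans ?_
  have := mk_iUnion_le_lift (fun n => closureLevel S n)
  simp only [lift_uzero, mk_nat, lift_aleph0] at this
  refine this.trans ?_
  exact (mul_le_mul' hc (ciSup_le' hlevel)).trans (mul_eq_self hc).le

/-- A Boolean subalgebra presented by generators is generated by them as an algebra. -/
theorem closure_preimage_coe_eq_top (S : Set F) :
    BooleanSubalgebra.closure {a : BooleanSubalgebra.closure S | (a : F) ∈ S} = ⊤ := by
  rw [eq_top_iff]
  rintro ⟨a, ha⟩ -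
  induction ha using BooleanSubalgebra.closure_bot_sup_induction with
  | mem x hx => exact BooleanSubalgebra.subset_closure hx
  | bot => exact BooleanSubalgebra.bot_mem
  | sup x _ y _ hx hy => exact BooleanSubalgebra.sup_mem hx hy
  | compl x _ hx => exact BooleanSubalgebra.compl_mem hx

end Generation

/-! ### Uniqueness of free products -/

section Coproduct

variable {ι : Type*} {C : ι → Type*} [∀ x, BooleanAlgebra (C x)]
  {F F' : Type*} [BooleanAlgebra F] [BooleanAlgebra F']

/-- Finite joins of finite meets of elements of the images of the homomorphisms `E x`. -/
inductive IsNormalForm (E : ∀ x, BoundedLatticeHom (C x) F) : F → Prop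
  | bot : IsNormalForm E ⊥
  | mono (s : Finset ι) (c : ∀ x, C x) : IsNormalForm E (s.inf fun x => E x (c x))
  | sup {a b : F} : IsNormalForm E a → IsNormalForm E b → IsNormalForm E (a ⊔ b)

namespace IsNormalForm

variable {E : ∀ x, BoundedLatticeHom (C x) F}

theorem inf_mono {a : F} (ha : IsNormalForm E a) (s : Finset ι) (c : ∀ x, C x) :
    IsNormalForm E (a ⊓ s.inf fun x => E x (c x)) := by
  classical
  induction ha with
  | bot => simpa using bot
  | sup _ _ iha ihb => rw [inf_sup_right]; exact iha.sup ihb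
  | mono t d =>
    -- Padding with ⊤ lets both meets run over `t ∪ s`, where they combine factor by factor.
    have key : ∀ (r r' : Finset ι) (e : ∀ x, C x), r ⊆ r' →
        (r.inf fun x => E x (e x)) = r'.inf fun x => E x (if x ∈ r then e x else ⊤) := by
      intro r r' e hr
      apply le_antisymm
      · refine Finset.le_inf fun x _ => ?_
        split_ifs with hx
        · exact Finset.inf_le (f := fun x => E x (e x)) hx
        · simp
      · refine Finset.le_inf fun x hx => ?_
        refine (Finset.inf_le (hr hx)).trans ?_
        simp [hx]
    rw [key t (t ∪ s) d Finset.subset_union_left, key s (t ∪ s) c Finset.subset_union_right,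
      ← Finset.inf_inf]
    have := mono (E := E) (t ∪ s) fun x => (if x ∈ t then d x else ⊤) ⊓ (if x ∈ s then c x else ⊤)
    simp only [map_inf] at this
    exact this

theorem inf {a b : F} (ha : IsNormalForm E a) (hb : IsNormalForm E b) :
    IsNormalForm E (a ⊓ b) := by
  induction hb with
  | bot => simpa using bot
  | mono s c => exact ha.inf_mono s c
  | sup _ _ iha ihb => rw [inf_sup_left]; exact iha.sup ihb

theorem compl {a : F} (ha : IsNormalForm E a) : IsNormalForm E aᶜ := by
  classical
  induction ha with
  | bot => simpa using mono (E := E) ∅ fun _ => ⊤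
  | sup _ _ iha ihb => rw [compl_sup]; exact iha.inf ihb
  | mono s c =>
    induction s using Finset.induction_on with
    | empty => simpa using bot
    | insert x s _ ih =>
      rw [Finset.inf_insert, compl_inf]
      refine sup ?_ ih
      simpa using mono (E := E) {x} fun y => (c y)ᶜ

/-- Reduces the question whether an element of the generated algebra vanishes to the case of a
single meet. -/
theorem of_mem_closure {a : F}
    (ha : a ∈ BooleanSubalgebra.closure {a | ∃ x c, a = E x c}) : IsNormalForm E a := by
  classical
  induction ha using BooleanSubalgebra.closure_bot_sup_induction with
  | mem a ha =>
    obtain ⟨x, c, rfl⟩ := ha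
    simpa using mono (E := E) {x} (Function.update (fun _ => ⊤) x c)
  | bot => exact bot
  | sup _ _ _ _ ha hb => exact ha.sup hb
  | compl _ _ ha => exact ha.compl

end IsNormalForm

/-- The homomorphisms `E x` are independent: finite meets of nonzero elements coming from
different algebras do not vanish. -/
def Independent (E : ∀ x, BoundedLatticeHom (C x) F) : Prop :=
  ∀ (s : Finset ι) (c : ∀ x, C x), (∀ x ∈ s, c x ≠ ⊥) → (s.inf fun x => E x (c x)) ≠ ⊥

/-- The right-hand side does not mention `E`, so two independent families have the same vanishing
meets. -/
theorem Independent.inf_eq_bot_iff {E : ∀ x, BoundedLatticeHom (C x) F} (hE : Independent E)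
    (s : Finset ι) (c : ∀ x, C x) : (s.inf fun x => E x (c x)) = ⊥ ↔ ∃ x ∈ s, c x = ⊥ := by
  refine ⟨fun h => ?_, ?_⟩
  · by_contra! hne
    exact hE s c hne h
  · rintro ⟨x, hx, hc⟩
    refine le_bot_iff.1 ((Finset.inf_le hx).trans ?_)
    simp [hc]

theorem nonempty_orderIso_of_surjective {T P Q : Type*} [PartialOrder P] [PartialOrder Q]
    (f : T → P) (g : T → Q) (hf : Function.Surjective f) (hg : Function.Surjective g)
    (h : ∀ a b, f a ≤ f b ↔ g a ≤ g b) : Nonempty (P ≃o Q) := by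
  have hfi := Function.rightInverse_surjInv hf
  refine ⟨RelIso.ofSurjective (OrderEmbedding.ofMapLEIff (fun p => g (Function.surjInv hf p))
    fun a b => by rw [← h, hfi, hfi]) fun q => ?_⟩
  obtain ⟨t, rfl⟩ := hg q
  have ht := hfi (f t)
  exact ⟨f t, le_antisymm ((h _ _).1 ht.le) ((h _ _).1 ht.ge)⟩

/-- The homomorphism into a product with the given components. -/
def prodHom {A : Type*} [BooleanAlgebra A] (f : BoundedLatticeHom A F)
    (g : BoundedLatticeHom A F') : BoundedLatticeHom A (F × F') where
  toFun a := (f a, g a)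
  map_sup' a b := by simp
  map_inf' a b := by simp
  map_top' := Prod.ext (map_top f) (map_top g)
  map_bot' := Prod.ext (map_bot f) (map_bot g)

theorem fst_finset_inf {α : Type*} (s : Finset α) (f : α → F × F') :
    (s.inf f).1 = s.inf fun x => (f x).1 := by
  classical
  induction s using Finset.induction_on with
  | empty => rfl
  | insert x s _ ih => rw [Finset.inf_insert, Finset.inf_insert, ← ih]; rfl

theorem snd_finset_inf {α : Type*} (s : Finset α) (f : α → F × F') :
    (s.inf f).2 = s.inf fun x => (f x).2 := by
  classical
  induction s using Finset.induction_on with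
  | empty => rfl
  | insert x s _ ih => rw [Finset.inf_insert, Finset.inf_insert, ← ih]; rfl

theorem exists_mem_closure_map_eq {f : BoundedLatticeHom F F'} {S : Set F} {T : Set F'}
    (hT : BooleanSubalgebra.closure T = ⊤) (hST : T ⊆ f '' S) (a : F') :
    ∃ u ∈ BooleanSubalgebra.closure S, f u = a := by
  have hle : BooleanSubalgebra.closure T ≤ (BooleanSubalgebra.closure S).map f :=
    BooleanSubalgebra.closure_le.2 (hST.trans (Set.image_mono BooleanSubalgebra.subset_closure))
  rw [hT] at hle
  exact hle trivial

/-- A Boolean algebra generated by independent images of the algebras `C x` is unique up to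
isomorphism. -/
theorem nonempty_orderIso_of_independent (E : ∀ x, BoundedLatticeHom (C x) F)
    (E' : ∀ x, BoundedLatticeHom (C x) F') (hE : Independent E) (hE' : Independent E')
    (hgen : BooleanSubalgebra.closure {a | ∃ x c, a = E x c} = ⊤)
    (hgen' : BooleanSubalgebra.closure {a | ∃ x c, a = E' x c} = ⊤) : Nonempty (F ≃o F') := by
  -- The subalgebra `R` of the product generated by the pairs (E x c, E' x c) is the graph of the
  -- isomorphism. Generation makes both projections onto; independence shows that they have the same
  -- kernel.
  let P := fun x => prodHom (E x) (E' x)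
  let R := BooleanSubalgebra.closure {a | ∃ x c, a = P x c}
  have hbot : ∀ u ∈ R, u.1 = ⊥ ↔ u.2 = ⊥ := by
    intro u hu
    have hu' := IsNormalForm.of_mem_closure hu
    clear hu
    induction hu' with
    | bot => simp
    | mono s c =>
      rw [fst_finset_inf, snd_finset_inf]
      exact (hE.inf_eq_bot_iff s c).trans (hE'.inf_eq_bot_iff s c).symm
    | sup ha hb iha ihb =>
      rw [Prod.fst_sup, Prod.snd_sup, sup_eq_bot_iff, sup_eq_bot_iff]
      exact and_congr iha ihb
  have hfst := exists_mem_closure_map_eq (S := {a | ∃ x c, a = P x c}) (f := ⟨LatticeHom.fst, rfl, rfl⟩)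
    hgen (by rintro _ ⟨x, c, rfl⟩; exact ⟨_, ⟨x, c, rfl⟩, rfl⟩)
  have hsnd := exists_mem_closure_map_eq (S := {a | ∃ x c, a = P x c}) (f := ⟨LatticeHom.snd, rfl, rfl⟩)
    hgen' (by rintro _ ⟨x, c, rfl⟩; exact ⟨_, ⟨x, c, rfl⟩, rfl⟩)
  refine nonempty_orderIso_of_surjective (T := R) (fun u => u.1.1) (fun u => u.1.2)
    (fun a => ?_) (fun a => ?_) fun u v => ?_
  · obtain ⟨u, hu, h⟩ := hfst a
    exact ⟨⟨u, hu⟩, h⟩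
  · obtain ⟨u, hu, h⟩ := hsnd a
    exact ⟨⟨u, hu⟩, h⟩
  -- Equal kernels give equal orders, since u ≤ v means that u \ v vanishes and `R` is closed under
  -- differences.
  · rw [← sdiff_eq_bot_iff, ← sdiff_eq_bot_iff]
    exact hbot _ (BooleanSubalgebra.sdiff_mem u.2 v.2)

end Coproduct

/-! ### Free products -/

section FreeProduct

/-- The complement of a prime ideal disjoint from the principal filter of `a` is an ultrafilter
containing `a`. -/
theorem exists_ult {A : BoolAlg.{u}} {a : A} (ha : a ≠ ⊥) : ∃ p : Ult A, p a := by
  have hdisj : Disjoint (Order.PFilter.principal a : Set A) (Order.Ideal.principal (⊥ : A)) := by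
    rw [Set.disjoint_left]
    intro x hx hx'
    exact ha (le_bot_iff.1 (le_trans hx hx'))
  obtain ⟨J, hJ, -, hd⟩ := DistribLattice.prime_ideal_of_disjoint_filter_ideal hdisj
  refine ⟨⟨⟨⟨fun b => b ∉ J, fun b c => ?_⟩, fun b c => ?_⟩, ?_, ?_⟩, ?_⟩
  · simp [Order.Ideal.sup_mem_iff, imp_iff_not_or]
  · have : b ⊓ c ∈ J ↔ b ∈ J ∨ c ∈ J :=
      ⟨hJ.mem_or_mem, fun h => h.elim (J.lower inf_le_left) (J.lower inf_le_right)⟩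
    simp [this]
  · have := hJ.top_notMem
    simpa using this
  · simp
  · exact Set.disjoint_left.1 hd (le_refl a)

variable {ι : Type u} (A : ι → BoolAlg.{u})

/-- The canonical embedding of a factor into the free product. -/
def cylinderHom (i : ι) : BoundedLatticeHom (A i) (freeProduct A) where
  toFun a := ⟨cylinder A i a, BooleanSubalgebra.subset_closure ⟨i, a, rfl⟩⟩
  map_sup' a b := Subtype.ext (Set.ext fun x => iff_of_eq (map_sup (x i) a b))
  map_inf' a b := Subtype.ext (Set.ext fun x => iff_of_eq (map_inf (x i) a b))
  map_top' := Subtype.ext (Set.ext fun x => iff_of_eq (map_top (x i)))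
  map_bot' := Subtype.ext (Set.ext fun x => iff_of_eq (map_bot (x i)))

theorem closure_cylinderHom :
    BooleanSubalgebra.closure {a | ∃ i c, a = cylinderHom A i c} = ⊤ := by
  refine Eq.trans ?_ (closure_preimage_coe_eq_top {s | ∃ i a, s = cylinder A i a})
  congr 1
  ext a
  exact exists_congr fun i => exists_congr fun c => Subtype.ext_iff

/-- A point of the product of Stone spaces is chosen coordinate by coordinate, so nonempty cylinders
over distinct factors have a common point. Nontriviality supplies the remaining coordinates. -/
theorem independent_cylinderHom (hA : ∀ i, Nontrivial (A i)) : Independent (cylinderHom A) := by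
  classical
  intro s c hc h
  have hex : ∀ i, ∃ p : Ult (A i), i ∈ s → p (c i) := by
    intro i
    by_cases hi : i ∈ s
    · obtain ⟨p, hp⟩ := exists_ult (hc i hi)
      exact ⟨p, fun _ => hp⟩
    · obtain ⟨p, -⟩ := exists_ult (A := A i) (a := ⊤) top_ne_bot
      exact ⟨p, fun h => (hi h).elim⟩
  choose p hp using hex
  have hmem : ∀ t ⊆ s, p ∈ ((t.inf fun i => cylinderHom A i (c i) : freeProduct A).1) := by
    intro t
    induction t using Finset.induction_on with
    | empty => exact fun _ => trivial
    | insert i t _ ih =>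
      intro ht
      rw [Finset.inf_insert]
      exact ⟨hp i (ht (Finset.mem_insert_self i t)),
        ih ((Finset.subset_insert i t).trans ht)⟩
  have := hmem s subset_rfl
  rw [h] at this
  exact this

end FreeProduct

/-! ### Ultraproducts modulo countably complete ultrafilters -/

section Ultraproduct

open Filter

variable {κ : Type*} (D : Ultrafilter κ)

/-- The class of a function in an ultraproduct. -/
def toProduct {A : κ → Type*} (f : ∀ i, A i) : (D : Filter κ).Product A := Quotient.mk _ f

/-- A function representing an element of an ultraproduct. -/
noncomputable def rep {A : κ → Type*} (x : (D : Filter κ).Product A) : ∀ i, A i := Quotient.out x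

variable {D}

theorem toProduct_surjective {A : κ → Type*} : Function.Surjective (toProduct D (A := A)) :=
  Quotient.mk_surjective

@[simp]
theorem toProduct_rep {A : κ → Type*} (x : (D : Filter κ).Product A) : toProduct D (rep D x) = x :=
  Quotient.out_eq x

theorem toProduct_eq_iff {A : κ → Type*} {f g : ∀ i, A i} :
    toProduct D f = toProduct D g ↔ ∀ᶠ i in (D : Filter κ), f i = g i :=
  Quotient.eq

theorem rep_toProduct {A : κ → Type*} (f : ∀ i, A i) :
    ∀ᶠ i in (D : Filter κ), rep D (toProduct D f) i = f i :=
  toProduct_eq_iff.1 (toProduct_rep _)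

theorem toProduct_le_iff {A : κ → Type*} [∀ i, PartialOrder (A i)] {f g : ∀ i, A i} :
    toProduct D f ≤ toProduct D g ↔ ∀ᶠ i in (D : Filter κ), f i ≤ g i :=
  Iff.rfl

theorem eventually_rep_ne {A : κ → Type*} {x y : (D : Filter κ).Product A} (h : x ≠ y) :
    ∀ᶠ i in (D : Filter κ), rep D x i ≠ rep D y i := by
  refine Ultrafilter.eventually_not.2 fun h' => h ?_
  rw [← toProduct_rep x, ← toProduct_rep y]
  exact toProduct_eq_iff.2 h'

/-- Only finitely many pairs must be separated, each on a set in `D`. This lets finite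
configurations in the ultraproduct be copied at a single coordinate. -/
theorem eventually_injOn_rep {A : κ → Type*} (s : Finset ((D : Filter κ).Product A)) :
    ∀ᶠ i in (D : Filter κ), Set.InjOn (fun x : (D : Filter κ).Product A => rep D x i) s := by
  have h : ∀ᶠ i in (D : Filter κ), ∀ x ∈ s, ∀ y ∈ s, x ≠ y → rep D x i ≠ rep D y i := by
    refine (eventually_all_finset s).2 fun x _ => (eventually_all_finset s).2 fun y _ => ?_
    by_cases hxy : x = y
    · exact Eventually.of_forall fun i h => (h hxy).elim
    · exact (eventually_rep_ne hxy).mono fun i h _ => h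
  exact h.mono fun i hi x hx y hy hxy => by_contra fun hne => hi x hx y hy hne hxy

theorem toProduct_finset_inf {A : κ → Type*} [∀ i, BooleanAlgebra (A i)] {ι : Type*} (s : Finset ι)
    (f : ι → ∀ i, A i) :
    (s.inf fun x => toProduct D (f x)) = toProduct D fun i => s.inf fun x => f x i := by
  classical
  induction s using Finset.induction_on with
  | empty => rfl
  | insert x s _ ih => simp only [Finset.inf_insert, ih]; rfl

/-- The form in which ℵ₁-completeness is used: a natural number depending on i can be taken constant
almost everywhere. -/
theorem exists_eventually_of_eventually_exists [CountableInterFilter (D : Filter κ)]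
    {p : ℕ → κ → Prop} (h : ∀ᶠ i in (D : Filter κ), ∃ n, p n i) :
    ∃ n, ∀ᶠ i in (D : Filter κ), p n i := by
  by_contra! hn
  have := eventually_countable_forall.2 hn
  obtain ⟨i, ⟨n, hi⟩, hi'⟩ := (h.and this).exists
  exact hi' n hi

/-- A countably complete ultraproduct is generated by the classes of functions with values in
given generating sets. -/
theorem closure_toProduct_eq_top [CountableInterFilter (D : Filter κ)] {Q : κ → Type*}
    [∀ i, BooleanAlgebra (Q i)] (S : ∀ i, Set (Q i))
    (hS : ∀ i, BooleanSubalgebra.closure (S i) = ⊤) :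
    BooleanSubalgebra.closure
      {a | ∃ f : ∀ i, Q i, (∀ᶠ i in (D : Filter κ), f i ∈ S i) ∧ a = toProduct D f} = ⊤ := by
  rw [eq_top_iff]
  rintro a -
  obtain ⟨f, rfl⟩ := toProduct_surjective a
  -- The number of operations needed to build `f i` may depend on i, but one n works almost
  -- everywhere; the construction is then unwound by induction on this n.
  have hf : ∀ i, ∃ n, f i ∈ closureLevel (S i) n := fun i =>
    exists_mem_closureLevel (hS i ▸ trivial)
  obtain ⟨n, hn⟩ := exists_eventually_of_eventually_exists (D := D) (Eventually.of_forall hf)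
  clear hf
  induction n generalizing f with
  | zero =>
    rcases Ultrafilter.eventually_or.1 hn with h | h
    · rw [toProduct_eq_iff.2 h]
      exact BooleanSubalgebra.bot_mem
    · exact BooleanSubalgebra.subset_closure ⟨f, h, rfl⟩
  | succ n ih =>
    rcases Ultrafilter.eventually_or.1 hn with h | h
    · rcases Ultrafilter.eventually_or.1 h with h | h
      · exact ih f h
      · have : ∀ i, ∃ a b, f i ∈ Set.image2 (· ⊔ ·) (closureLevel (S i) n) (closureLevel (S i) n) →
            a ∈ closureLevel (S i) n ∧ b ∈ closureLevel (S i) n ∧ a ⊔ b = f i := by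
          intro i
          by_cases hi : f i ∈ Set.image2 (· ⊔ ·) (closureLevel (S i) n) (closureLevel (S i) n)
          · obtain ⟨a, ha, b, hb, hab⟩ := hi
            exact ⟨a, b, fun _ => ⟨ha, hb, hab⟩⟩
          · exact ⟨⊥, ⊥, fun h => (hi h).elim⟩
        choose a b hab using this
        have hfab : toProduct D f = toProduct D a ⊔ toProduct D b :=
          toProduct_eq_iff.2 (h.mono fun i hi => (hab i hi).2.2.symm)
        rw [hfab]
        exact BooleanSubalgebra.sup_mem (ih a (h.mono fun i hi => (hab i hi).1))
          (ih b (h.mono fun i hi => (hab i hi).2.1))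
    · have hc : toProduct D f = (toProduct D fun i => (f i)ᶜ)ᶜ :=
        toProduct_eq_iff.2 (Eventually.of_forall fun i => (compl_compl (f i)).symm)
      rw [hc]
      refine BooleanSubalgebra.compl_mem (ih _ (h.mono ?_))
      rintro i ⟨a, ha, hai⟩
      simpa [← hai] using ha

theorem finite_setOf_eventually_rep_mem [CountableInterFilter (D : Filter κ)] {A : κ → Type*}
    [∀ i, Nonempty (A i)] (S : ∀ i, Set (A i)) (hS : ∀ᶠ i in (D : Filter κ), (S i).Finite) :
    {x : (D : Filter κ).Product A | ∀ᶠ i in (D : Filter κ), rep D x i ∈ S i}.Finite := by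
  -- Once n is fixed almost everywhere, the classes of the n enumerating functions exhaust the set:
  -- the ultrafilter decides which entry a given representative equals.
  have h : ∀ᶠ i in (D : Filter κ), ∃ n, ∃ l : Fin n → A i, S i ⊆ Set.range l := by
    refine hS.mono fun i hi => ?_
    have := hi.to_subtype
    obtain ⟨n, ⟨e⟩⟩ := Finite.exists_equiv_fin (S i)
    exact ⟨n, fun k => e.symm k, fun a ha => ⟨e ⟨a, ha⟩, by simp⟩⟩
  obtain ⟨n, hn⟩ := exists_eventually_of_eventually_exists h
  have : ∀ i, ∃ l : Fin n → A i, (∃ l : Fin n → A i, S i ⊆ Set.range l) → S i ⊆ Set.range l := by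
    intro i
    by_cases hi : ∃ l : Fin n → A i, S i ⊆ Set.range l
    · exact hi.imp fun l hl _ => hl
    · exact ⟨fun _ => Classical.arbitrary _, fun h => (hi h).elim⟩
  choose l hl using this
  refine (Set.finite_range fun k => toProduct D fun i => l i k).subset fun x hx => ?_
  have hk : ∀ᶠ i in (D : Filter κ), ∃ k, l i k = rep D x i :=
    (hx.and hn).mono fun i hi => hl i hi.2 hi.1
  obtain ⟨k, hk⟩ := Ultrafilter.eventually_exists_iff.1 hk
  exact ⟨k, (toProduct_eq_iff.2 hk).trans (toProduct_rep x)⟩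

/-- The homomorphism of ultraproducts induced by homomorphisms of the factors. -/
def productHom {A Q : κ → Type*} [∀ i, BooleanAlgebra (A i)] [∀ i, BooleanAlgebra (Q i)]
    (h : ∀ i, BoundedLatticeHom (A i) (Q i)) :
    BoundedLatticeHom ((D : Filter κ).Product A) ((D : Filter κ).Product Q) where
  toFun := Quotient.map (fun f i => h i (f i)) fun _ _ hf => hf.mono fun i hi => congrArg (h i) hi
  map_sup' := by
    rintro ⟨f⟩ ⟨g⟩
    exact toProduct_eq_iff.2 (Eventually.of_forall fun i => map_sup (h i) (f i) (g i))
  map_inf' := by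
    rintro ⟨f⟩ ⟨g⟩
    exact toProduct_eq_iff.2 (Eventually.of_forall fun i => map_inf (h i) (f i) (g i))
  map_top' := toProduct_eq_iff.2 (Eventually.of_forall fun i => map_top (h i))
  map_bot' := toProduct_eq_iff.2 (Eventually.of_forall fun i => map_bot (h i))

theorem infinite_product {A : κ → Type*} [∀ i, Infinite (A i)] :
    Infinite ((D : Filter κ).Product A) := by
  refine Infinite.of_injective (fun n : ℕ => toProduct D fun i => Infinite.natEmbedding (A i) n) ?_
  intro m n h
  obtain ⟨i, hi⟩ := (toProduct_eq_iff.1 h).exists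
  exact (Infinite.natEmbedding (A i)).injective hi

end Ultraproduct

/-! ### Ultraproducts of free products and of weak products -/

section Commute

open Filter

/-- A family prescribed along a map that is injective on a finite set, with given default values. -/
theorem exists_extend_of_injOn {X ι : Type*} {C : ι → Type*} (s : Finset X) (j : X → ι)
    (hj : Set.InjOn j s) (d : ∀ x, C (j x)) (z : ∀ y, C y) :
    ∃ c : ∀ y, C y, (∀ x ∈ s, c (j x) = d x) ∧ ∀ y, (∀ x ∈ s, j x ≠ y) → c y = z y := by
  classical
  induction s using Finset.induction_on with
  | empty => exact ⟨z, by simp, fun _ _ => rfl⟩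
  | insert a s ha ih =>
    obtain ⟨c, hc, hz⟩ := ih (hj.mono (by simp))
    refine ⟨Function.update c (j a) (d a), fun x hx => ?_, fun y hy => ?_⟩
    · by_cases hxa : x = a
      · subst hxa
        simp
      · have hxs : x ∈ s := (Finset.mem_insert.1 hx).resolve_left hxa
        rw [Function.update_of_ne fun h => hxa (hj hx (Finset.mem_insert_self a s) h), hc x hxs]
    · rw [Function.update_of_ne (hy a (Finset.mem_insert_self a s)).symm]
      exact hz y fun x hx => hy x (Finset.mem_insert_of_mem hx)

theorem Independent.inf_ne_bot_of_injOn {X ι : Type*} {C : ι → Type*}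
    [∀ x, BooleanAlgebra (C x)] {F : Type*} [BooleanAlgebra F]
    {E : ∀ x, BoundedLatticeHom (C x) F} (hE : Independent E) (s : Finset X) (j : X → ι)
    (hj : Set.InjOn j s) (d : ∀ x, C (j x)) (hd : ∀ x ∈ s, d x ≠ ⊥) :
    (s.inf fun x => E (j x) (d x)) ≠ ⊥ := by
  classical
  obtain ⟨c, hc, -⟩ := exists_extend_of_injOn s j hj d fun _ => ⊥
  have := hE (s.image j) c (by
    simp only [Finset.mem_image, forall_exists_index, and_imp, forall_apply_eq_imp_iff₂]
    intro x hx
    rw [hc x hx]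
    exact hd x hx)
  rw [Finset.inf_image] at this
  rwa [Finset.inf_congr rfl fun x hx => by rw [← hc x hx]]

variable {κ : Type u} {D : Ultrafilter κ} [CountableInterFilter (D : Filter κ)]
  {Λ : κ → Type u} [∀ i, Nonempty (Λ i)] (A : ∀ i, Λ i → BoolAlg.{u})

/-- An ultraproduct of free products modulo a countably complete ultrafilter is the free product,
over the ultraproduct of the index sets, of the ultraproducts of the factors. -/
theorem nonempty_orderIso_ultraprod_freeProduct (hA : ∀ i α, Nontrivial (A i α)) :
    Nonempty (ultraprod D (fun i => freeProduct (A i)) ≃o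
      freeProduct fun x : (D : Filter κ).Product Λ => ultraprod D fun i => A i (rep D x i)) := by
  let E : ∀ x : (D : Filter κ).Product Λ, BoundedLatticeHom (ultraprod D fun i => A i (rep D x i))
      (ultraprod D fun i => freeProduct (A i)) :=
    fun x => productHom fun i => cylinderHom (A i) (rep D x i)
  refine nonempty_orderIso_of_independent E (cylinderHom _) ?_
    (independent_cylinderHom _ fun x => ?_) ?_ (closure_cylinderHom _)
  · intro s c hc h
    choose d hd using fun x => toProduct_surjective (D := D) (c x)
    have hE : ∀ x, E x (c x) = toProduct D fun i => cylinderHom (A i) (rep D x i) (d x i) :=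
      fun x => by rw [← hd x]; rfl
    have hd' : ∀ᶠ i in (D : Filter κ), ∀ x ∈ s, d x i ≠ ⊥ := by
      refine (eventually_all_finset s).2 fun x hx => Ultrafilter.eventually_not.2 fun h => hc x hx ?_
      rw [← hd x]
      exact toProduct_eq_iff.2 h
    simp only [hE] at h
    have h' := (toProduct_finset_inf (D := D) (A := fun i => freeProduct (A i)) s
      fun x i => cylinderHom (A i) (rep D x i) (d x i)).symm.trans h
    -- At one coordinate the meet vanishes, all factors are nonzero and the indices are distinct,
    -- against independence in `freeProduct (A i)`.
    obtain ⟨i, ⟨h1, h2⟩, h3⟩ := (((toProduct_eq_iff.1 h').and hd').and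
      (eventually_injOn_rep s)).exists
    exact (independent_cylinderHom (A i) (hA i)).inf_ne_bot_of_injOn s (fun x => rep D x i) h3
      (fun x => d x i) h2 h1
  · refine ⟨⊥, ⊤, fun h => ?_⟩
    obtain ⟨i, hi⟩ := (toProduct_eq_iff (D := D).1 h).exists
    exact bot_ne_top hi
  · refine eq_top_iff.2 ((closure_toProduct_eq_top (D := D) (Q := fun i => freeProduct (A i))
      (fun i => {a | ∃ α c, a = cylinderHom (A i) α c})
      fun i => closure_cylinderHom (A i)).ge.trans (BooleanSubalgebra.closure_mono ?_))
    rintro _ ⟨f, hf, rfl⟩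
    have : ∀ i, ∃ α, (∃ α c, f i = cylinderHom (A i) α c) → ∃ c, f i = cylinderHom (A i) α c := by
      intro i
      by_cases hi : ∃ α c, f i = cylinderHom (A i) α c
      · exact hi.imp fun α hα _ => hα
      · exact ⟨Classical.arbitrary _, fun h => (hi h).elim⟩
    choose α hα using this
    -- The chosen representative of the class of `α` agrees with `α` only almost everywhere, so `c`
    -- is chosen relative to that representative.
    have h1 : ∀ᶠ i in (D : Filter κ),
        ∃ c, f i = cylinderHom (A i) (rep D (toProduct D α) i) c := by
      filter_upwards [hf, rep_toProduct (D := D) α] with i hi hi'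
      rw [hi']
      exact hα i hi
    have : ∀ i, ∃ c, (∃ c, f i = cylinderHom (A i) (rep D (toProduct D α) i) c) →
        f i = cylinderHom (A i) (rep D (toProduct D α) i) c := by
      intro i
      by_cases hi : ∃ c, f i = cylinderHom (A i) (rep D (toProduct D α) i) c
      · exact hi.imp fun c hc _ => hc
      · exact ⟨⊥, fun h => (hi h).elim⟩
    choose c hc using this
    exact ⟨toProduct D α, toProduct D c, toProduct_eq_iff.2 (h1.mono fun i hi => hc i hi)⟩

/-- An ultraproduct of weak products modulo a countably complete ultrafilter is the weak product,
over the ultraproduct of the index sets, of the ultraproducts of the factors. -/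
theorem nonempty_orderIso_ultraprod_weakProduct :
    Nonempty (ultraprod D (fun i => weakProduct (A i)) ≃o
      weakProduct fun x : (D : Filter κ).Product Λ => ultraprod D fun i => A i (rep D x i)) := by
  let C : (D : Filter κ).Product Λ → BoolAlg.{u} := fun x => ultraprod D fun i => A i (rep D x i)
  let g : (∀ i, weakSubalgebra (A i)) → ∀ x, C x :=
    fun t x => toProduct D fun i => (t i).1 (rep D x i)
  have hg : ∀ t, g t ∈ weakSubalgebra C := by
    intro t
    -- Applied with `z` constantly ⊥ or ⊤: x is exceptional for `g t` only if its representative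
    -- lies in the finite exceptional set of `t i` almost everywhere.
    have key : ∀ z : ∀ (i) (α : Λ i), A i α,
        (∀ᶠ i in (D : Filter κ), {α | (t i).1 α ≠ z i α}.Finite) →
        {x | g t x ≠ toProduct D fun i => z i (rep D x i)}.Finite := by
      intro z hz
      refine (finite_setOf_eventually_rep_mem _ hz).subset fun x hx => ?_
      exact Ultrafilter.eventually_not.2 fun h => hx (toProduct_eq_iff.2 h)
    rcases Ultrafilter.eventually_or.1 (Eventually.of_forall fun i => (t i).2) with h | h
    · exact Or.inl (key (fun _ _ => ⊥) h)
    · exact Or.inr (key (fun _ _ => ⊤) h)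
  -- Where the representatives of the support of `c` are distinct, `t i` takes the prescribed values
  -- at them and ⊥ elsewhere; at the remaining, negligible coordinates `t i` is ⊥.
  have hsurj : ∀ c : ∀ x, C x, {x | c x ≠ ⊥}.Finite → ∃ t, g t = c := by
    intro c hc
    have hex : ∀ i, ∃ t : weakSubalgebra (A i),
        (Set.InjOn (fun x => rep D x i) (hc.toFinset : Set ((D : Filter κ).Product Λ)) →
          ∀ x ∈ hc.toFinset, t.1 (rep D x i) = rep D (c x) i) ∧
        ∀ α, (∀ x ∈ hc.toFinset, rep D x i ≠ α) → t.1 α = ⊥ := by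
      intro i
      by_cases hi : Set.InjOn (fun x => rep D x i) (hc.toFinset : Set ((D : Filter κ).Product Λ))
      · obtain ⟨t, h1, h2⟩ := exists_extend_of_injOn (C := fun α => A i α) hc.toFinset
          (fun x => rep D x i) hi (fun x => rep D (c x) i) fun _ => ⊥
        refine ⟨⟨t, Or.inl ((hc.toFinset.finite_toSet.image fun x => rep D x i).subset ?_)⟩,
          fun _ => h1, h2⟩
        intro α hα
        by_contra h
        exact hα (h2 α fun x hx hxα => h ⟨x, hx, hxα⟩)
      · exact ⟨⊥, fun h => (hi h).elim, fun _ _ => rfl⟩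
    choose t h1 h2 using hex
    refine ⟨t, funext fun x => ?_⟩
    by_cases hx : x ∈ hc.toFinset
    · refine Eq.trans (toProduct_eq_iff.2 ?_) (toProduct_rep (D := D) (c x))
      exact (eventually_injOn_rep hc.toFinset).mono fun i hi => h1 i hi x hx
    · have hcx : c x = ⊥ := by simpa using hx
      rw [hcx]
      refine toProduct_eq_iff.2 ?_
      have : ∀ᶠ i in (D : Filter κ), ∀ y ∈ hc.toFinset, rep D y i ≠ rep D x i :=
        (eventually_all_finset _).2 fun y hy => eventually_rep_ne fun h => hx (h ▸ hy)
      exact this.mono fun i hi => h2 i _ hi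
  refine nonempty_orderIso_of_surjective (T := ∀ i, weakSubalgebra (A i)) (toProduct D)
    (fun t => (⟨g t, hg t⟩ : weakSubalgebra C)) toProduct_surjective ?_ fun a b => ⟨?_, ?_⟩
  · rintro ⟨c, hc | hc⟩
    · obtain ⟨t, ht⟩ := hsurj c hc
      exact ⟨t, Subtype.ext ht⟩
    · obtain ⟨t, ht⟩ := hsurj cᶜ (hc.subset fun x hx h => hx (by simp [h]))
      refine ⟨fun i => (t i)ᶜ, Subtype.ext ?_⟩
      change (g t)ᶜ = c
      rw [ht, compl_compl]
  · intro h x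
    exact toProduct_le_iff.2 ((toProduct_le_iff.1 h).mono fun i hi => hi _)
  · intro h
    by_contra hab
    -- Witnesses `α i` to the failure of `a i ≤ b i` form a class in the new index set, and `g a ≤ g
    -- b` fails at that index.
    have hne : ∀ᶠ i in (D : Filter κ), ¬ a i ≤ b i := Ultrafilter.eventually_not.2 hab
    have : ∀ i, ∃ α, ¬ a i ≤ b i → ¬ (a i).1 α ≤ (b i).1 α := by
      intro i
      by_cases hi : a i ≤ b i
      · exact ⟨Classical.arbitrary _, fun h => (h hi).elim⟩
      · have : ∃ α, ¬ (a i).1 α ≤ (b i).1 α := by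
          by_contra! hle
          exact hi hle
        exact this.imp fun α hα _ => hα
    choose α hα using this
    have hx : ∀ᶠ i in (D : Filter κ), (a i).1 (rep D (toProduct D α) i) ≤
        (b i).1 (rep D (toProduct D α) i) := h (toProduct D α)
    obtain ⟨i, ⟨h1, h2⟩, h3⟩ := ((hne.and hx).and (rep_toProduct (D := D) α)).exists
    rw [h3] at h2
    exact hα i h1 h2

end Commute

/-! ### Size of free products and of weak products -/

section Size

variable {ι : Type u} (A : ι → BoolAlg.{u})

theorem mk_sigma_le {c : Cardinal.{u}} (hc : ℵ₀ ≤ c) (hι : #ι ≤ c) (hA : ∀ i, #(A i) ≤ c) :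
    #(Σ i, A i) ≤ c := by
  rw [mk_sigma]
  refine (sum_le_mk_mul_iSup _).trans ?_
  exact (mul_le_mul' hι (ciSup_le' hA)).trans (mul_eq_self hc).le

theorem mk_freeProduct_le {c : Cardinal.{u}} (hc : ℵ₀ ≤ c) (hι : #ι ≤ c) (hA : ∀ i, #(A i) ≤ c) :
    #(freeProduct A) ≤ c := by
  refine mk_closure_le hc (le_trans ?_ (mk_sigma_le A hc hι hA))
  refine (mk_le_mk_of_subset ?_).trans
    (mk_range_le (f := fun p : Σ i, A i => cylinder A p.1 p.2))
  rintro s ⟨i, a, rfl⟩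
  exact ⟨⟨i, a⟩, rfl⟩

open Classical in
theorem mem_closure_update {a : ∀ i, A i} (ha : {i | a i ≠ ⊥}.Finite) :
    a ∈ BooleanSubalgebra.closure
      (Set.range fun p : Σ i, A i => Function.update (⊥ : ∀ i, A i) p.1 p.2) := by
  have key : ∀ (s : Finset ι) (a : ∀ i, A i), (∀ i ∉ s, a i = ⊥) → a ∈ BooleanSubalgebra.closure
      (Set.range fun p : Σ i, A i => Function.update (⊥ : ∀ i, A i) p.1 p.2) := by
    intro s
    induction s using Finset.induction_on with
    | empty =>
      intro a ha
      rw [show a = ⊥ from funext fun i => ha i (by simp)]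
      exact BooleanSubalgebra.bot_mem
    | insert i s _ ih =>
      intro a ha
      have h : a = Function.update (⊥ : ∀ i, A i) i (a i) ⊔ Function.update a i ⊥ := by
        funext j
        by_cases hj : j = i
        · subst hj
          simp
        · simp [hj]
      rw [h]
      refine BooleanSubalgebra.sup_mem (BooleanSubalgebra.subset_closure ⟨⟨i, a i⟩, rfl⟩)
        (ih _ fun j hj => ?_)
      by_cases hji : j = i
      · subst hji
        simp
      · rw [Function.update_of_ne hji]
        exact ha j (by simp [hji, hj])
  exact key ha.toFinset a fun i hi => by simpa using hi

theorem mk_weakProduct_le {c : Cardinal.{u}} (hc : ℵ₀ ≤ c) (hι : #ι ≤ c) (hA : ∀ i, #(A i) ≤ c) :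
    #(weakProduct A) ≤ c := by
  classical
  refine le_trans ?_ (mk_closure_le hc (mk_range_le.trans (mk_sigma_le A hc hι hA))
    (S := Set.range fun p : Σ i, A i => Function.update (⊥ : ∀ i, A i) p.1 p.2))
  refine mk_le_mk_of_subset ?_
  rintro a (ha | ha)
  · exact mem_closure_update A ha
  · rw [← compl_compl a]
    exact BooleanSubalgebra.compl_mem (mem_closure_update A
      (ha.subset fun i hi h => hi (by simp [h])))

variable [Nonempty ι]

theorem infinite_freeProduct (hA : ∀ i, Infinite (A i)) : Infinite (freeProduct A) := by
  let i : ι := Classical.arbitrary ι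
  refine Infinite.of_injective (cylinderHom A i) ?_
  have hle : ∀ a b, cylinderHom A i a ≤ cylinderHom A i b → a ≤ b := by
    intro a b h
    by_contra hab
    have hne : a \ b ≠ ⊥ := fun h => hab (sdiff_eq_bot_iff.1 h)
    have := (independent_cylinderHom A fun i => inferInstance).inf_ne_bot_of_injOn
      {()} (fun _ => i) (by simp) (fun _ => a \ b) fun _ _ => hne
    rw [Finset.inf_singleton, map_sdiff', sdiff_eq_bot_iff.2 h] at this
    exact this rfl
  exact fun a b h => le_antisymm (hle a b h.le) (hle b a h.ge)

theorem infinite_weakProduct (hA : ∀ i, Infinite (A i)) : Infinite (weakProduct A) := by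
  classical
  let i : ι := Classical.arbitrary ι
  refine Infinite.of_injective (α := weakSubalgebra A) (β := A i)
    (fun a => ⟨Function.update ⊥ i a, Or.inl ((Set.finite_singleton i).subset fun j hj => ?_)⟩) ?_
  · by_contra h
    exact hj (Function.update_of_ne h _ _)
  · intro a b h
    simpa using congrFun (congrArg Subtype.val h) i

end Size

/-! ### Cardinal invariants -/

theorem Theory.isInvariant_inv (T : Theory.{u}) : IsInvariant T.inv := by
  have key : ∀ A B : BoolAlg.{u}, (A ≃o B) →
      {c | ∃ P : ∀ n, Set (Fin (T.arity n) → A), T.Models A P ∧ c = #(P 0)} ⊆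
      {c | ∃ P : ∀ n, Set (Fin (T.arity n) → B), T.Models B P ∧ c = #(P 0)} := by
    rintro A B e c ⟨P, hP, rfl⟩
    refine ⟨_, T.models_of_iso A B e P hP, ?_⟩
    exact (mk_image_eq e.injective.comp_left).symm
  rintro A B - ⟨e⟩
  exact congrArg sSup ((key A B e).antisymm (key B A e.symm))

/-- `P 0` consists of tuples of a fixed finite length, and an infinite set has no more of these than
elements. -/
theorem Theory.inv_le (T : Theory.{u}) (B : BoolAlg.{u}) [Infinite B] : T.inv B ≤ #B := by
  refine csSup_le' ?_
  rintro c ⟨P, -, rfl⟩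
  refine (mk_set_le _).trans ?_
  rw [mk_pi, prod_const, mk_fin]
  simpa using power_nat_le (aleph0_le_mk B) (n := T.arity 0)

/-! ### The counterexample -/

theorem exists_mk_initialSegment_eq {χ c : Cardinal.{u}} (h : χ < c) :
    ∃ a : c.ord.ToType, #{b : c.ord.ToType // b < a} = χ := by
  have ho : χ.ord < Ordinal.type (α := c.ord.ToType) (· < ·) := by
    rw [Ordinal.type_toType]
    exact ord_lt_ord.2 h
  refine ⟨Ordinal.enum (α := c.ord.ToType) (· < ·) ⟨χ.ord, ho⟩, ?_⟩
  have := Ordinal.card_typein (α := c.ord.ToType) (r := (· < ·))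
    (x := Ordinal.enum (α := c.ord.ToType) (· < ·) ⟨χ.ord, ho⟩)
  rw [Ordinal.typein_enum, card_ord] at this
  exact this.symm

theorem mk_initialSegment_lt {c : Cardinal.{u}} (a : c.ord.ToType) :
    #{b : c.ord.ToType // b < a} < c := by
  have := mk_Iio_lt a (by simp)
  rw [mk_ord_toType] at this
  exact this

/-- An ultraproduct of algebras of size less than `lam i` is no larger than some proper initial
segment of the ultraproduct of the cardinals `lam i`. -/
theorem exists_mk_product_le {κ : Type u} (D : Ultrafilter κ) (lam : κ → Cardinal.{u})
    (A : κ → Type u) (hA : ∀ i, #(A i) < lam i) :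
    ∃ a : CardProd D lam, #((D : Filter κ).Product A) ≤ #{b : CardProd D lam // b < a} := by
  choose a ha using fun i => exists_mk_initialSegment_eq (hA i)
  -- Each `A i` is identified with the segment below `a i`; doing so coordinatewise embeds the
  -- ultraproduct below the class of `a`.
  have e := fun i => (Cardinal.eq.1 (ha i)).some
  refine ⟨toProduct D a, mk_le_of_injective (f := fun x =>
    ⟨toProduct D fun i => ((e i).symm (rep D x i)).1,
      (lt_iff D _ _).2 (Filter.Eventually.of_forall fun i => ((e i).symm (rep D x i)).2)⟩) ?_⟩
  intro x y h
  have h' := toProduct_eq_iff.1 (congrArg Subtype.val h)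
  rw [← toProduct_rep x, ← toProduct_rep y]
  exact toProduct_eq_iff.2 (h'.mono fun i hi => (e i).symm.injective (Subtype.ext hi))

theorem aleph0_le_of_isLike_succ {κ : Type u} {D : Ultrafilter κ} {lam : κ → Cardinal.{u}}
    (hlam : ∀ i, ℵ₀ ≤ lam i) {μ : Cardinal.{u}} (h : #(CardProd D lam) = Order.succ μ) :
    ℵ₀ ≤ μ := by
  have hinf : ∀ i, Infinite (lam i).ord.ToType := fun i => by
    rw [infinite_iff]
    simpa using hlam i
  have : Infinite (CardProd D lam) := infinite_product
  by_contra! hμ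
  have h1 := aleph0_le_mk (CardProd D lam)
  rw [h] at h1
  exact (isSuccLimit_aleph0.succ_lt hμ).not_ge h1

/-- The construction for an operation `O` that does not increase infinite cardinalities and that
commutes with countably complete ultraproducts. -/
theorem exists_family_of_square
    (O : ∀ {ι : Type u}, (ι → BoolAlg.{u}) → BoolAlg.{u})
    (hOcard : ∀ {ι : Type u} (A : ι → BoolAlg.{u}) {c : Cardinal.{u}}, ℵ₀ ≤ c → #ι ≤ c →
      (∀ i, #(A i) ≤ c) → #(O A) ≤ c)
    (hOinf : ∀ {ι : Type u} (A : ι → BoolAlg.{u}) [Nonempty ι], (∀ i, Infinite (A i)) →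
      Infinite (O A))
    {κ : Type u} (D : Ultrafilter κ)
    (hOprod : ∀ {Λ : κ → Type u} [∀ i, Nonempty (Λ i)] (A : ∀ i, Λ i → BoolAlg.{u}),
      (∀ i α, Infinite (A i α)) → Nonempty (ultraprod D (fun i => O (A i)) ≃o
        O fun x : (D : Filter κ).Product Λ => ultraprod D fun i => A i (rep D x i)))
    (τ : BoolAlg.{u} → Cardinal.{u}) (hinv : IsInvariant τ)
    (hle : ∀ B : BoolAlg.{u}, Infinite B → τ B ≤ #B) (hsq : Square τ O)
    (hlarge : ∀ χ : Cardinal.{u}, ℵ₀ ≤ χ → ∃ B : BoolAlg.{u}, Infinite B ∧ χ ≤ τ B ∧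
      ∀ c : Cardinal.{u}, χ < c → c ≤ #B → ¬ IsWeaklyInaccessible c)
    (lam : κ → Cardinal.{u}) (hlam : ∀ i, IsWeaklyInaccessible (lam i))
    (μ : Cardinal.{u}) (hlike : IsLike (CardProd D lam) (Order.succ μ)) :
    ∃ B : κ → BoolAlg.{u}, (∀ i, Infinite (B i)) ∧ (∀ i, τ (B i) = lam i) ∧
      τ (ultraprod D B) ≤ μ := by
  have hμ : ℵ₀ ≤ μ := aleph0_le_of_isLike_succ (fun i => (hlam i).1.le) hlike.1
  have hne : ∀ i, Nonempty (lam i).ord.ToType := fun i => by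
    rw [← mk_ne_zero_iff, mk_ord_toType]
    exact (aleph0_pos.trans (hlam i).1).ne'
  have hchoice : ∀ i (α : (lam i).ord.ToType), ∃ B : BoolAlg.{u}, Infinite B ∧
      #{b : (lam i).ord.ToType // b < α} ≤ τ B ∧ #B < lam i := by
    intro i α
    -- The maximum with ℵ₀ covers finite segments; it is still below `lam i`, which is uncountable.
    obtain ⟨B, hB, hτB, hno⟩ := hlarge (max ℵ₀ #{b : (lam i).ord.ToType // b < α}) (le_max_left _ _)
    refine ⟨B, hB, (le_max_right _ _).trans hτB, ?_⟩
    by_contra! hlt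
    exact hno _ (max_lt (hlam i).1 (mk_initialSegment_lt α)) hlt (hlam i)
  choose A hAinf hAτ hAcard using hchoice
  have hBinf : ∀ i, Infinite (O (A i)) := fun i => hOinf (A i) (hAinf i)
  refine ⟨fun i => O (A i), hBinf, fun i => le_antisymm ?_ ?_, ?_⟩
  · exact (hle _ (hBinf i)).trans (hOcard (A i) (hlam i).1.le (mk_ord_toType _).le
      fun α => (hAcard i α).le)
  · refine le_trans ?_ ((hsq (lam i) (hlam i).1.le).1 _ (A i) (mk_ord_toType _) (hAinf i))
    -- As `lam i` is a limit cardinal, some index has an initial segment of size χ⁺, which gives the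
    -- strict inequality.
    refine le_of_forall_lt fun χ hχ => ?_
    obtain ⟨α, hα⟩ := exists_mk_initialSegment_eq ((hlam i).2.2.succ_lt hχ)
    refine (Order.lt_succ χ).trans_le ?_
    rw [← hα]
    exact (hAτ i α).trans (le_ciSup bddAbove_of_small α)
  · obtain ⟨e⟩ := hOprod A hAinf
    have hCinf : ∀ x : CardProd D lam, Infinite (ultraprod D fun i => A i (rep D x i)) :=
      fun x => infinite_product (A := fun i => A i (rep D x i))
    rw [hinv _ _ (infinite_product (A := fun i => O (A i))) ⟨e⟩]
    refine ((hsq μ hμ).2 (CardProd D lam) _ hlike.1 hCinf).trans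
      (add_le_of_le hμ le_rfl (ciSup_le' fun x => (hle _ (hCinf x)).trans ?_))
    -- Here μ⁺-likeness enters: the segment below `a` has size less than μ⁺, hence at most μ.
    obtain ⟨a, ha⟩ := exists_mk_product_le D lam (fun i => A i (rep D x i)) fun i => hAcard i _
    exact ha.trans (Order.lt_succ_iff.1 (hlike.2 a))

end BAInv

theorem mainTheorem11
    (τ : BoolAlg.{u} → Cardinal.{u})
    (hτ : (∃ T : BAInv.Theory.{u}, τ = T.inv) ∨
      (BAInv.IsInvariant τ ∧ ∀ B : BoolAlg.{u}, Infinite B → τ B ≤ #B))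
    (hsq : BAInv.Square τ BAInv.freeProduct ∨ BAInv.Square τ BAInv.weakProduct)
    (hlarge : ∀ χ : Cardinal.{u}, ℵ₀ ≤ χ → ∃ B : BoolAlg.{u}, Infinite B ∧ χ ≤ τ B ∧
      ∀ c : Cardinal.{u}, χ < c → c ≤ #B → ¬ BAInv.IsWeaklyInaccessible c)
    {κ : Type u} (lam : κ → Cardinal.{u})
    (hlam : ∀ i, BAInv.IsWeaklyInaccessible (lam i))
    (hκ : ∀ i, Order.succ #κ < lam i)
    (D : Ultrafilter κ) (hD : CountableInterFilter (D : Filter κ))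
    (μ : Cardinal.{u})
    (hlike : BAInv.IsLike (BAInv.CardProd D lam) (Order.succ μ)) :
    ∃ B : κ → BoolAlg.{u},
      (∀ i, Infinite (B i)) ∧
      (∀ i, τ (B i) = lam i) ∧
      τ (BAInv.ultraprod D B) ≤ μ ∧
      #(BAInv.CardProd D fun i => τ (B i)) = Order.succ μ ∧
      τ (BAInv.ultraprod D B) < #(BAInv.CardProd D fun i => τ (B i)) := by
  have hτ' : BAInv.IsInvariant τ ∧ ∀ B : BoolAlg.{u}, Infinite B → τ B ≤ #B := by
    rcases hτ with ⟨T, rfl⟩ | h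
    · exact ⟨T.isInvariant_inv, fun B _ => T.inv_le B⟩
    · exact h
  have hB : ∃ B : κ → BoolAlg.{u}, (∀ i, Infinite (B i)) ∧ (∀ i, τ (B i) = lam i) ∧
      τ (BAInv.ultraprod D B) ≤ μ := by
    rcases hsq with h | h
    · exact BAInv.exists_family_of_square BAInv.freeProduct
        (fun A _ => BAInv.mk_freeProduct_le A) (fun A _ => BAInv.infinite_freeProduct A) D
        (fun A hA => BAInv.nonempty_orderIso_ultraprod_freeProduct A fun i α => inferInstance)
        τ hτ'.1 hτ'.2 h hlarge lam hlam μ hlike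
    · exact BAInv.exists_family_of_square BAInv.weakProduct
        (fun A _ => BAInv.mk_weakProduct_le A) (fun A _ => BAInv.infinite_weakProduct A) D
        (fun A _ => BAInv.nonempty_orderIso_ultraprod_weakProduct A)
        τ hτ'.1 hτ'.2 h hlarge lam hlam μ hlike
  obtain ⟨B, hinf, hlamB, hle⟩ := hB
  have hcard : #(BAInv.CardProd D fun i => τ (B i)) = Order.succ μ := by
    rw [show (fun i => τ (B i)) = lam from funext hlamB]
    exact hlike.1
  exact ⟨B, hinf, hlamB, hle, hcard, hcard ▸ Order.lt_succ_iff.2 hle⟩
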